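/- Let $2\le p<\infty$. For a natural number $n\ge 2$ let $d_n$ be the best (smallest) constant for which $$\sum_{k=1}^{n}\Big(\frac1k\sum_{j=1}^{k}a_j\Big)^p\le d_n\sum_{k=1}^{n}a_k^p\qquad\text{for all } a_1,\dots,a_n\ge 0;$$ this smallest constant exists. Moreover, for every $n\ge2$ the equation $$\tan(\alpha\ln(n+1))+\frac{\alpha p}{p-1}=0$$ has exactly one solution $\alpha=\alpha_n$ in the interval $\left(\frac{\pi}{2\ln(n+1)},\frac{\pi}{\ln(n+1)}\right)$. For this $\alpha$ put $$f^*(x)=\frac1{x^{1/p}}\left(\frac{\alpha p}{p-1}\cos(\alpha\ln x)+\sin(\alpha\ln x)\right)\quad(1\le x\le n+1),\qquad a_k^*=\int_k^{k+1}f^*(x)\,dx\quad(1\le k\le n);$$ then $a_k^*>0$ for $1\le k\le n$. (i) There are constants $c_3,c_4>0$, depending only on $p$, such that for every $n\ge2$ $$\left(\frac p{p-1}\right)^p-\frac{c_3}{\ln^2 n}\le d_n\le\left(\frac p{p-1}\right)^p-\frac{c_4}{\ln^2 n},$$ and the sequence $(a_k^*)$ is almost extremal, in the sense that, with the same $c_3$,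 $$\sum_{k=1}^{n}\Big(\frac1k\sum_{j=1}^{k}a_j^*\Big)^p\ge\left(\left(\frac p{p-1}\right)^p-\frac{c_3}{\ln^2 n}\right)\sum_{k=1}^{n}(a_k^*)^p .$$ (ii) Let $C(p)=\left(\frac p{p-1}\right)^{p+1}p\,\pi^2$. There is $N=N(p)$ such that for all $n\ge N$ the lower bound for $d_n$ and the inequality for $(a_k^*)$ in (i) hold with $c_3$ replaced by $C(p)$. (iii) For $p=2$ this constant is exact: $\lim_{n\to\infty}(4-d_n)\ln^2 n=C(2)=16\pi^2$. -/

import Mathlib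

noncomputable section

/-- `∑_{k=1}^n ((1/k) ∑_{j=1}^k a_j)^p`. -/
def hardySum (p : ℝ) (n : ℕ) (a : ℕ → ℝ) : ℝ :=
  ∑ k ∈ Finset.Icc 1 n, ((1 / (k : ℝ)) * ∑ j ∈ Finset.Icc 1 k, a j) ^ p

/-- `∑_{k=1}^n a_k^p`. -/
def powerSum (p : ℝ) (n : ℕ) (a : ℕ → ℝ) : ℝ :=
  ∑ k ∈ Finset.Icc 1 n, a k ^ p

/-- The constants `d` for which the discrete Hardy inequality for `n` terms holds
for all non-negative `a_1, …, a_n`. -/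
def hardyConstants (p : ℝ) (n : ℕ) : Set ℝ :=
  {d | ∀ a : ℕ → ℝ, (∀ k ∈ Finset.Icc 1 n, 0 ≤ a k) →
    hardySum p n a ≤ d * powerSum p n a}

/-- The best constant `d_n` in the discrete Hardy inequality for `n` terms. -/
def hardyConst (p : ℝ) (n : ℕ) : ℝ := sInf (hardyConstants p n)

/-- `α` solves `tan (α ln (n+1)) + α p / (p-1) = 0` in `(π / (2 ln (n+1)), π / ln (n+1))`. -/
def IsHardyRoot (p : ℝ) (n : ℕ) (α : ℝ) : Prop :=
  α ∈ Set.Ioo (Real.pi / (2 * Real.log ((n : ℝ) + 1))) (Real.pi / Real.log ((n : ℝ) + 1)) ∧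
    Real.tan (α * Real.log ((n : ℝ) + 1)) + α * p / (p - 1) = 0

/-- The function `f*` with parameter `α`. -/
def fStar (p α x : ℝ) : ℝ :=
  1 / x ^ (1 / p) *
    (α * p / (p - 1) * Real.cos (α * Real.log x) + Real.sin (α * Real.log x))

/-- `a_k* = ∫_k^{k+1} f*(x) dx`. -/
def aStar (p α : ℝ) (k : ℕ) : ℝ :=
  ∫ x in (k : ℝ)..((k : ℝ) + 1), fStar p α x

end

/-! Write q = p/(p-1), A_k = a_1 + … + a_k and L = ln(n+1). Upper bounds for `hardyConst` come from
a discrete Riccati inequality (`mul_hardySum_le_powerSum`): positive weights z_k that satisfy it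
with a constant E make 1/E admissible. Weights q k (1 + λ ln k) with λ of order 1/ln² n raise E
above q^(-p) by a factor 1 + c/ln² n. For p = 2, the exact solution 2x/(1 + 2α cot(φ + α ln x)) of
the continuous Riccati equation, with α close to π/ln n, gives the sharp E = (1 + 4α²)/4. The lower
bound tests with `aStar`. The primitive of f* is q x^(1-1/p) sin(α ln x), and the equation for α
turns f* into x^(-1/p) sin(α(L - ln x))/κ, with κ² (1 + (αq)²) = 1. After the substitution x = e^t
both sums are compared with the same integral of sin(αt)^p over [0, L] (`RootData.powerSum_le`,
`RootData.le_hardySum`), so the quotient is at least q^p κ^p. Expanding κ^p and using α < π/ln n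
gives C(p); for p = 2 the two bounds meet. -/

/-! ### The Riccati criterion -/

open Real in
theorem one_sub_mul_le_one_add_rpow_neg {s r : ℝ} (hs : -1 < s) (hr : 0 ≤ r) :
    1 - r * s ≤ (1 + s) ^ (-r) := by
  have h0 : 0 < 1 + s := by linarith
  rw [rpow_def_of_pos h0]
  have h1 : log (1 + s) ≤ s := by linarith [log_le_sub_one_of_pos h0]
  have h2 := add_one_le_exp (log (1 + s) * -r)
  nlinarith [mul_le_mul_of_nonneg_right h1 hr]

/-- Convexity of t^p at the points a and b/z with weights 1/(1+z) and z/(1+z). Equality holds for b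
= z a, so a good z_k imitates A_k / a_(k+1) of an extremal sequence. -/
theorem add_rpow_le_weighted {p z a b : ℝ} (hp : 1 ≤ p) (hz : 0 < z) (ha : 0 ≤ a) (hb : 0 ≤ b) :
    (a + b) ^ p * (1 + z) ^ (-(p - 1)) ≤ a ^ p + z ^ (-(p - 1)) * b ^ p := by
  have h1z : 0 < 1 + z := by linarith
  have hc := (convexOn_rpow hp).right (Set.mem_Ici.2 ha) (Set.mem_Ici.2 (div_nonneg hb hz.le))
    (show 0 ≤ 1 / (1 + z) by positivity) (show 0 ≤ z / (1 + z) by positivity) (by field_simp)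
  simp only [smul_eq_mul] at hc
  have e1 : 1 / (1 + z) * a + z / (1 + z) * (b / z) = (a + b) / (1 + z) := by field_simp
  rw [e1, Real.div_rpow (by positivity) h1z.le, Real.div_rpow hb hz.le] at hc
  have e2 : (1 + z) ^ (-(p - 1)) = (1 + z) / (1 + z) ^ p := by
    rw [show -(p - 1) = 1 - p by ring, Real.rpow_sub h1z, Real.rpow_one]
  have e3 : z ^ (-(p - 1)) = z / z ^ p := by
    rw [show -(p - 1) = 1 - p by ring, Real.rpow_sub hz, Real.rpow_one]
  rw [e2, e3]
  have h := mul_le_mul_of_nonneg_left hc h1z.le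
  have hA : 0 < (1 + z) ^ p := Real.rpow_pos_of_pos h1z p
  have hB : 0 < z ^ p := Real.rpow_pos_of_pos hz p
  calc (a + b) ^ p * ((1 + z) / (1 + z) ^ p) = (1 + z) * ((a + b) ^ p / (1 + z) ^ p) := by ring
    _ ≤ _ := h
    _ = _ := by field_simp

/-- A discrete Riccati criterion for the Hardy inequality. -/
theorem mul_hardySum_le_powerSum {p E : ℝ} (hp : 1 ≤ p) {n : ℕ} {z : ℕ → ℝ}
    (hz : ∀ k, 1 ≤ k → k ≤ n → 0 < z k) (h1 : z 1 ^ (-(p - 1)) + E ≤ 1)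
    (hstep : ∀ k : ℕ, 1 ≤ k → k < n →
      z (k + 1) ^ (-(p - 1)) + ((k : ℝ) + 1) ^ (-p) * E ≤ (1 + z k) ^ (-(p - 1)))
    {a : ℕ → ℝ} (ha : ∀ k ∈ Finset.Icc 1 n, 0 ≤ a k) :
    E * hardySum p n a ≤ powerSum p n a := by
  rcases Nat.eq_zero_or_pos n with rfl | hn
  · simp [hardySum, powerSum]
  -- The extra term in A_m^p is the reserve that pays for the next step; it is discarded at m = n.
  have key : ∀ m, 1 ≤ m → m ≤ n →
      E * hardySum p m a + z m ^ (-(p - 1)) * (∑ j ∈ Finset.Icc 1 m, a j) ^ p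
        ≤ powerSum p m a := by
    intro m hm
    induction m, hm using Nat.le_induction with
    | base =>
      intro _
      have := Real.rpow_nonneg (ha 1 (by simp; omega)) p
      simp only [hardySum, powerSum, Finset.Icc_self, Finset.sum_singleton, Nat.cast_one, div_one,
        one_mul]
      nlinarith [mul_le_mul_of_nonneg_right h1 this]
    | succ m hm ih =>
      intro hmn
      have ih := ih (by omega)
      have hs := hstep m hm (by omega)
      simp only [hardySum, powerSum] at ih ⊢
      rw [Finset.sum_Icc_succ_top (by omega), Finset.sum_Icc_succ_top (by omega),
        Finset.sum_Icc_succ_top (by omega)]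
      set A := ∑ j ∈ Finset.Icc 1 m, a j with hA
      have hA0 : 0 ≤ A := Finset.sum_nonneg fun j hj => ha j (by
        simp only [Finset.mem_Icc] at hj ⊢; omega)
      have ha1 : 0 ≤ a (m + 1) := ha _ (by simp; omega)
      have hw := add_rpow_le_weighted hp (hz m hm (by omega)) ha1 hA0
      have hpow : 0 ≤ (A + a (m + 1)) ^ p := Real.rpow_nonneg (by linarith) p
      have hm0 : (0 : ℝ) < (m : ℝ) + 1 := by positivity
      have e1 : (1 / ((m + 1 : ℕ) : ℝ) * (A + a (m + 1))) ^ p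
          = ((m : ℝ) + 1) ^ (-p) * (A + a (m + 1)) ^ p := by
        push_cast
        rw [Real.mul_rpow (by positivity) (by linarith), one_div, Real.inv_rpow hm0.le,
          Real.rpow_neg hm0.le]
      rw [e1]
      rw [add_comm (a (m + 1)) A] at hw
      nlinarith [mul_le_mul_of_nonneg_right hs hpow]
  have h := key n hn le_rfl
  have : 0 ≤ z n ^ (-(p - 1)) * (∑ j ∈ Finset.Icc 1 n, a j) ^ p :=
    mul_nonneg (Real.rpow_nonneg (hz n hn le_rfl).le _)
      (Real.rpow_nonneg (Finset.sum_nonneg ha) _)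
  linarith

/-! ### The set of admissible constants -/

theorem powerSum_nonneg {p : ℝ} {n : ℕ} {a : ℕ → ℝ} (ha : ∀ k ∈ Finset.Icc 1 n, 0 ≤ a k) :
    0 ≤ powerSum p n a :=
  Finset.sum_nonneg fun k hk => Real.rpow_nonneg (ha k hk) p

theorem hardySum_nonneg {p : ℝ} {n : ℕ} {a : ℕ → ℝ} (ha : ∀ k ∈ Finset.Icc 1 n, 0 ≤ a k) :
    0 ≤ hardySum p n a :=
  Finset.sum_nonneg fun k hk => Real.rpow_nonneg (mul_nonneg (by positivity)
    (Finset.sum_nonneg fun j hj => ha j (by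
      simp only [Finset.mem_Icc] at hj hk ⊢; omega))) p

theorem bddBelow_hardyConstants {p : ℝ} (hp : p ≠ 0) {n : ℕ} (hn : 1 ≤ n) :
    BddBelow (hardyConstants p n) := by
  refine ⟨0, fun d hd => ?_⟩
  have ha : ∀ k ∈ Finset.Icc 1 n, (0 : ℝ) ≤ if k = 1 then 1 else 0 := by
    intro k _; split_ifs <;> norm_num
  have h := hd _ ha
  have h1 : powerSum p n (fun k => if k = 1 then 1 else 0) = 1 := by
    unfold powerSum
    rw [Finset.sum_eq_single 1]
    · simp
    · intro b _ hb
      simp [hb, Real.zero_rpow hp]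
    · intro h; simp at h; omega
  have h0 := hardySum_nonneg (p := p) ha
  rw [h1] at h
  linarith

/-- Closedness is what makes the infimum `hardyConst` attained. -/
theorem isClosed_hardyConstants (p : ℝ) (n : ℕ) : IsClosed (hardyConstants p n) := by
  simp only [hardyConstants, Set.ofPred_forall]
  exact isClosed_iInter fun a => isClosed_iInter fun _ =>
    isClosed_le continuous_const (continuous_id.mul continuous_const)

theorem inv_mem_hardyConstants {p E : ℝ} {n : ℕ} (hE : 0 < E)
    (h : ∀ a : ℕ → ℝ, (∀ k ∈ Finset.Icc 1 n, 0 ≤ a k) → E * hardySum p n a ≤ powerSum p n a) :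
    1 / E ∈ hardyConstants p n := by
  intro a ha
  rw [one_div, inv_mul_eq_div, le_div_iff₀ hE, mul_comm]
  exact h a ha

/-! ### Upper bound for all p ≥ 2 -/

open Real in
theorem le_mul_log_succ_sub {k : ℝ} (hk : 1 ≤ k) :
    2 / (2 * k + 1) ≤ log (k + 1) - log k := by
  have hk0 : 0 < k := by linarith
  have h := le_log_one_add_of_nonneg (x := 1 / k) (by positivity)
  rw [← log_div (by positivity) hk0.ne']
  convert h using 1
  · field_simp; ring
  · congr 1; field_simp

/-- The Riccati step for the weights `q x (1 + lam ln x)`, with `q = p / (p - 1)`. -/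
theorem riccati_step_log {p q lam δ L k : ℝ} (hp : 2 ≤ p) (hq : q = p / (p - 1))
    (hlam : lam * (8 * p ^ 2 * L ^ 2) = 1) (hδ : δ = p * lam / 4) (hL : 1 / 2 ≤ L)
    (hk : 1 ≤ k) (hkL : Real.log (k + 1) ≤ L) :
    (q * (k + 1) * (1 + lam * Real.log (k + 1))) ^ (-(p - 1)) +
        (k + 1) ^ (-p) * (q ^ (-p) * (1 + δ))
      ≤ (1 + q * k * (1 + lam * Real.log k)) ^ (-(p - 1)) := by
  have hp1 : 0 < p - 1 := by linarith
  have hq0 : 0 < q := by rw [hq]; positivity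
  have hqp : (p - 1) * q = p := by rw [hq]; field_simp
  have hL0 : 0 < L := by linarith
  have hlam0 : 0 < lam := by
    rw [eq_div_of_mul_eq (by positivity) hlam]
    positivity
  have hlk : 0 ≤ Real.log k := Real.log_nonneg hk
  set l := Real.log (k + 1) with hl
  have hl0 : 0 ≤ l := Real.log_nonneg (by linarith)
  have hd : 2 / (2 * k + 1) ≤ l - Real.log k := le_mul_log_succ_sub hk
  have hd2 : 1 / 2 ≤ k * (l - Real.log k) := by
    have := mul_le_mul_of_nonneg_left hd (show 0 ≤ k by linarith)
    have h3 : 1 / 2 ≤ k * (2 / (2 * k + 1)) := by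
      rw [← mul_div_assoc, div_le_div_iff₀ (by norm_num) (by linarith)]; linarith
    linarith
  set m := 1 + lam * l with hm
  have hm1 : 1 ≤ m := by have := mul_nonneg hlam0.le hl0; linarith
  set Y := q * (k + 1) * m with hY
  have hY0 : 0 < Y := by positivity
  set W := 1 + q * k * (1 + lam * Real.log k) with hW
  have hW0 : 0 < W := by positivity
  -- tangent line at `Y`
  have hs : -1 < W / Y - 1 := by have := div_pos hW0 hY0; linarith
  have hB := one_sub_mul_le_one_add_rpow_neg hs hp1.le
  have e1 : 1 + (W / Y - 1) = W / Y := by ring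
  rw [e1, Real.div_rpow hW0.le hY0.le, le_div_iff₀ (Real.rpow_pos_of_pos hY0 _)] at hB
  refine le_trans ?_ hB
  have e2 : Y ^ (-(p - 1)) = Y * Y ^ (-p) := by
    rw [show -(p - 1) = 1 + -p by ring, Real.rpow_add hY0, Real.rpow_one]
  have e3 : Y ^ (-p) = q ^ (-p) * (k + 1) ^ (-p) * m ^ (-p) := by
    rw [hY, Real.mul_rpow (by positivity) (by positivity),
      Real.mul_rpow hq0.le (by positivity)]
  have hmp : 1 - p * (lam * l) ≤ m ^ (-p) :=
    one_sub_mul_le_one_add_rpow_neg (by have := mul_nonneg hlam0.le hl0; linarith) (by linarith)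
  have hh : 1 + p * lam * (l + 1 / 2) ≤ (p - 1) * (Y - W) := by
    have : Y - W = q * (1 + lam * (l + k * (l - Real.log k))) - 1 := by
      rw [hY, hW, hm]; ring
    rw [this, mul_sub, ← mul_assoc, hqp]
    have h1 := mul_le_mul_of_nonneg_left hd2 (show 0 ≤ p * lam by positivity)
    linarith
  have hlamL : lam * (p ^ 2 * L ^ 2) = 1 / 8 := by linarith
  have hlamll : p ^ 2 * lam * (l * (l + 1 / 2)) ≤ 1 / 4 := by
    have : l * (l + 1 / 2) ≤ L * (2 * L) := by
      apply mul_le_mul hkL (by linarith) (by linarith) hL0.le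
    have := mul_le_mul_of_nonneg_left this (show 0 ≤ p ^ 2 * lam by positivity)
    have e : p ^ 2 * lam * (L * (2 * L)) = 2 * (lam * (p ^ 2 * L ^ 2)) := by ring
    linarith
  -- The first-order terms in `lam * l` cancel, leaving a gain p·lam/2. The quadratic loss is at
  -- most lam/4 because lam = 1/(8p²L²), so δ = p·lam/4 is affordable.
  have hfin : 1 + δ ≤ (p - 1) * (Y - W) * m ^ (-p) := by
    calc 1 + δ ≤ (1 + p * lam * (l + 1 / 2)) * (1 - p * (lam * l)) := by
          rw [hδ]
          have h1 := mul_le_mul_of_nonneg_left hlamll hlam0.le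
          have h2 : 2 * lam ≤ p * lam := mul_le_mul_of_nonneg_right hp hlam0.le
          linarith
      _ ≤ (1 + p * lam * (l + 1 / 2)) * m ^ (-p) :=
          mul_le_mul_of_nonneg_left hmp (by positivity)
      _ ≤ _ := mul_le_mul_of_nonneg_right hh (Real.rpow_nonneg (by linarith) _)
  have e4 : (1 - (p - 1) * (W / Y - 1)) * Y ^ (-(p - 1))
      = Y ^ (-(p - 1)) + (p - 1) * (Y - W) * Y ^ (-p) := by
    rw [e2]; field_simp; ring
  rw [e4, e3]
  have hc : 0 ≤ q ^ (-p) * (k + 1) ^ (-p) := by positivity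
  have h1 := mul_le_mul_of_nonneg_left hfin hc
  linarith

/-- Bernoulli with exponent p - 1 ≥ 1. It serves the initial condition of the criterion at z_1 = q,
which reads q + 1 + δ ≤ q^p; hence δ ≤ q - 1 suffices. -/
theorem two_mul_conj_le_rpow {p : ℝ} (hp : 2 ≤ p) :
    2 * (p / (p - 1)) ≤ (p / (p - 1)) ^ p := by
  have hp1 : 0 < p - 1 := by linarith
  have h := one_add_mul_self_le_rpow_one_add (s := 1 / (p - 1))
    (by have : 0 < 1 / (p - 1) := by positivity
        linarith) (show 1 ≤ p - 1 by linarith)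
  have e : 1 + 1 / (p - 1) = p / (p - 1) := by field_simp; ring
  rw [e] at h
  have hq0 : 0 < p / (p - 1) := by positivity
  have e2 : (p / (p - 1)) ^ p = p / (p - 1) * (p / (p - 1)) ^ (p - 1) := by
    have h1 := Real.rpow_add hq0 1 (p - 1)
    rwa [add_sub_cancel, Real.rpow_one] at h1
  rw [e2]
  have : 1 + (p - 1) * (1 / (p - 1)) = 2 := by field_simp; norm_num
  rw [this] at h
  nlinarith

theorem exists_mem_hardyConstants_le {p : ℝ} (hp : 2 ≤ p) {n : ℕ} (hn : 2 ≤ n) :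
    ∃ d ∈ hardyConstants p n,
      d ≤ (p / (p - 1)) ^ p - ((p / (p - 1)) ^ p / (64 * p)) / Real.log n ^ 2 := by
  have hp1 : 0 < p - 1 := by linarith
  set q := p / (p - 1) with hq
  have hq0 : 0 < q := by positivity
  set L := Real.log n with hLdef
  have hL : 1 / 2 ≤ L := by
    have h2 : Real.log 2 ≤ L := Real.log_le_log (by norm_num) (by exact_mod_cast hn)
    linarith [Real.log_two_gt_d9]
  have hL0 : 0 < L := by linarith
  set lam := 1 / (8 * p ^ 2 * L ^ 2) with hlam
  have hlam1 : lam * (8 * p ^ 2 * L ^ 2) = 1 := by rw [hlam]; field_simp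
  have hlam0 : 0 < lam := by positivity
  set δ := p * lam / 4 with hδ
  have hδ0 : 0 < δ := by positivity
  have hδe : δ = 1 / (32 * p * L ^ 2) := by rw [hδ, hlam]; field_simp; norm_num
  have hδp : δ ≤ 1 / p := by
    rw [hδe]
    apply one_div_le_one_div_of_le (by linarith)
    nlinarith [mul_le_mul hL hL (by norm_num) hL0.le]
  have hδ1 : δ ≤ 1 := hδp.trans (by rw [div_le_one (by linarith)]; linarith)
  have hδq : δ ≤ q - 1 := by
    refine hδp.trans ?_
    have : q - 1 = 1 / (p - 1) := by rw [hq]; field_simp; ring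
    rw [this]
    exact one_div_le_one_div_of_le hp1 (by linarith)
  have hqp : 0 < q ^ p := Real.rpow_pos_of_pos hq0 p
  have hE : 0 < q ^ (-p) * (1 + δ) := by positivity
  refine ⟨1 / (q ^ (-p) * (1 + δ)), inv_mem_hardyConstants hE fun a ha => ?_, ?_⟩
  · refine mul_hardySum_le_powerSum (by linarith)
      (z := fun k => q * k * (1 + lam * Real.log k)) ?_ ?_ ?_ ha
    · intro k hk _
      have : 0 ≤ Real.log k := Real.log_natCast_nonneg k
      have hk0 : (0 : ℝ) < k := by exact_mod_cast hk
      positivity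
    · simp only [Nat.cast_one, mul_one, Real.log_one, mul_zero, add_zero]
      have h2 : 2 * q ≤ q ^ p := two_mul_conj_le_rpow hp
      have e : q ^ (-(p - 1)) = q / q ^ p := by
        rw [show -(p - 1) = 1 - p by ring, Real.rpow_sub hq0, Real.rpow_one]
      rw [e, Real.rpow_neg hq0.le, inv_mul_eq_div, ← add_div, div_le_one hqp]
      linarith
    · intro k hk hkn
      have := riccati_step_log hp hq hlam1 hδ hL (k := k) (by exact_mod_cast hk)
        (Real.log_le_log (by positivity) (by exact_mod_cast hkn))
      simpa using this
  · have e1 : 1 / (q ^ (-p) * (1 + δ)) = q ^ p * (1 / (1 + δ)) := by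
      rw [Real.rpow_neg hq0.le]; field_simp
    -- For 0 ≤ δ ≤ 1 one has 1/(1+δ) ≤ 1 - δ/2, and δ/2 = 1/(64 p L²).
    have e2 : q ^ p - q ^ p / (64 * p) / L ^ 2 = q ^ p * (1 - δ / 2) := by
      rw [hδe]; field_simp; ring
    rw [e1, e2]
    apply mul_le_mul_of_nonneg_left _ hqp.le
    rw [div_le_iff₀ (by linarith)]
    nlinarith

theorem isLeast_hardyConst {p : ℝ} (hp : 2 ≤ p) {n : ℕ} (hn : 2 ≤ n) :
    IsLeast (hardyConstants p n) (hardyConst p n) := by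
  have hb := bddBelow_hardyConstants (show p ≠ 0 by linarith) (show 1 ≤ n by omega)
  obtain ⟨d, hd, -⟩ := exists_mem_hardyConstants_le hp hn
  exact ⟨(isClosed_hardyConstants p n).csInf_mem ⟨d, hd⟩ hb, fun x hx => csInf_le hb hx⟩

/-! ### Sharp upper bound for p = 2 -/

open Real in
theorem mul_cos_le_sin {x : ℝ} (h0 : 0 ≤ x) (hpi : x ≤ π) : x * cos x ≤ sin x := by
  rcases lt_or_ge x (π / 2) with h | h
  · have hc : 0 < cos x := cos_pos_of_mem_Ioo ⟨by linarith [pi_pos], h⟩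
    have := le_tan h0 h
    rwa [tan_eq_sin_div_cos, le_div_iff₀ hc] at this
  · have hc : cos x ≤ 0 := cos_nonpos_of_pi_div_two_le_of_le h (by linarith [pi_pos])
    have hs : 0 ≤ sin x := sin_nonneg_of_nonneg_of_le_pi h0 hpi
    nlinarith

open Real in
theorem cot_le_inv {x : ℝ} (h0 : 0 < x) (hpi : x < π) : cot x ≤ 1 / x := by
  rw [cot_eq_cos_div_sin, div_le_div_iff₀ (sin_pos_of_pos_of_lt_pi h0 hpi) h0]
  linarith [mul_cos_le_sin h0.le hpi.le]

open Real in
theorem neg_inv_le_cot {x : ℝ} (h0 : 0 < x) (hpi : x < π) : -(1 / (π - x)) ≤ cot x := by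
  have h := cot_le_inv (x := π - x) (by linarith) (by linarith)
  rw [cot_eq_cos_div_sin, cos_pi_sub, sin_pi_sub, neg_div, ← cot_eq_cos_div_sin] at h
  linarith

open Real in
/-- The Riccati step for `p = 2` and the weights `2 x / (1 + 2 α cot (φ + α ln x))`. -/
theorem riccati_step_cot {α φ k : ℝ} (hα : 0 < α) (hk : 1 ≤ k)
    (h0 : 0 < φ + α * log k) (hpi : φ + α * log (k + 1) < π)
    (hlow : 0 < 1 + 2 * α * cot (φ + α * log k)) (hup : 2 * α * cot (φ + α * log k) ≤ 1) :
    (1 + 2 * α * cot (φ + α * log (k + 1))) / (2 * (k + 1)) +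
        (1 + 4 * α ^ 2) / (4 * (k + 1) ^ 2)
      ≤ (1 + 2 * k / (1 + 2 * α * cot (φ + α * log k)))⁻¹ := by
  have hd : 2 / (2 * k + 1) ≤ log (k + 1) - log k := le_mul_log_succ_sub hk
  rw [div_le_iff₀ (by linarith)] at hd
  have hlog : log k < log (k + 1) := log_lt_log (by linarith) (by linarith)
  set x := φ + α * log k with hx
  set y := φ + α * log (k + 1) with hy
  have hxy : y - x = α * (log (k + 1) - log k) := by rw [hx, hy]; ring
  have hΔ0 : 0 < y - x := by rw [hxy]; exact mul_pos hα (by linarith)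
  have hsx : 0 < sin x := sin_pos_of_pos_of_lt_pi h0 (by linarith)
  have hsy : 0 < sin y := sin_pos_of_pos_of_lt_pi (by linarith) hpi
  -- By the addition formulas the whole step reduces to this. It follows from Δ cos Δ ≤ sin Δ for Δ
  -- = y - x, and the midpoint bound on ln(k+1) - ln k gives exactly (2k+1)Δ ≥ 2α.
  have hΔ : 2 * α * cos (y - x) ≤ (2 * k + 1) * sin (y - x) := by
    have h1 : 2 * α ≤ (2 * k + 1) * (y - x) := by
      rw [hxy]; nlinarith
    have h2 := mul_cos_le_sin hΔ0.le (by linarith)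
    rcases le_or_gt (cos (y - x)) 0 with hc | hc
    · have : 0 < sin (y - x) := sin_pos_of_pos_of_lt_pi hΔ0 (by linarith)
      have h3 : 0 < (2 * k + 1) * sin (y - x) := by positivity
      nlinarith
    · calc 2 * α * cos (y - x) ≤ (2 * k + 1) * (y - x) * cos (y - x) :=
            mul_le_mul_of_nonneg_right h1 hc.le
        _ = (2 * k + 1) * ((y - x) * cos (y - x)) := by ring
        _ ≤ _ := mul_le_mul_of_nonneg_left h2 (by linarith)
  have e1 : cot x - cot y = sin (y - x) / (sin x * sin y) := by
    rw [cot_eq_cos_div_sin, cot_eq_cos_div_sin, sin_sub]; field_simp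
  have e2 : 1 + cot x * cot y = cos (y - x) / (sin x * sin y) := by
    rw [cot_eq_cos_div_sin, cot_eq_cos_div_sin, cos_sub]; field_simp; ring
  have hN : 2 * α * (1 + cot x * cot y) ≤ (2 * k + 1) * (cot x - cot y) := by
    rw [e1, e2, ← mul_div_assoc, ← mul_div_assoc]
    exact div_le_div_of_nonneg_right hΔ (by positivity)
  set c := cot x
  set d := cot y
  -- The upper bound on the cotangent enters here: it lets the denominator below be enlarged to
  -- 4(k+1)².
  have hs2 : 2 * k + (1 + 2 * α * c) ≤ 2 * (k + 1) := by linarith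
  have hs0 : 0 < 2 * k + (1 + 2 * α * c) := by linarith
  have hK : 0 < k + 1 := by linarith
  have e3 : (1 + 2 * k / (1 + 2 * α * c))⁻¹ = (1 + 2 * α * c) / (2 * k + (1 + 2 * α * c)) := by
    field_simp; ring
  have hN2 : 1 + 4 * α ^ 2 ≤ (2 * k + 1) * (2 * α) * (c - d) + 1 - 4 * α ^ 2 * (c * d) := by
    have := mul_le_mul_of_nonneg_left hN (show 0 ≤ 2 * α by linarith)
    linarith
  have e4 : (1 + 2 * α * c) / (2 * k + (1 + 2 * α * c)) - (1 + 2 * α * d) / (2 * (k + 1))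
      = ((2 * k + 1) * (2 * α) * (c - d) + 1 - 4 * α ^ 2 * (c * d)) /
        (2 * (k + 1) * (2 * k + (1 + 2 * α * c))) := by
    rw [div_sub_div _ _ hs0.ne' (by positivity)]
    rw [div_eq_div_iff (by positivity) (by positivity)]
    ring
  have h5 : (1 + 4 * α ^ 2) / (4 * (k + 1) ^ 2) ≤
      ((2 * k + 1) * (2 * α) * (c - d) + 1 - 4 * α ^ 2 * (c * d)) /
        (2 * (k + 1) * (2 * k + (1 + 2 * α * c))) := by
    apply div_le_div₀ (le_trans (by positivity) hN2) hN2 (by positivity)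
    nlinarith
  rw [e3]
  linarith

open Real in
theorem mem_hardyConstants_two {n : ℕ} (hn : 1 ≤ n) {α : ℝ} (hα : α = π / (log n + 12)) :
    4 / (1 + 4 * α ^ 2) ∈ hardyConstants 2 n := by
  have hL : 0 ≤ log n := log_natCast_nonneg n
  have hα0 : 0 < α := by rw [hα]; positivity
  have hαL : α * (log n + 12) = π := by rw [hα]; field_simp
  have hα3 : α < 1 / 3 := by nlinarith [pi_lt_four]
  -- The phase runs from 8α to π - 4α, which explains the 12 in α. The left margin gives 2α cot ≤
  -- 1/4, the right one 1 + 2α cot ≥ 1/2. The initial condition then needs α² ≤ 1/8, supplied by α <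
  -- 1/3.
  have hb : ∀ k : ℕ, 1 ≤ k → k ≤ n →
      8 * α ≤ 8 * α + α * log k ∧ 8 * α + α * log k ≤ π - 4 * α := by
    intro k hk hkn
    have h1 := mul_nonneg hα0.le (log_natCast_nonneg k)
    have h2 : log k ≤ log n := log_le_log (by exact_mod_cast hk) (by exact_mod_cast hkn)
    have h3 := mul_le_mul_of_nonneg_left h2 hα0.le
    constructor <;> linarith
  have hup : ∀ k : ℕ, 1 ≤ k → k ≤ n → 2 * α * cot (8 * α + α * log k) ≤ 1 / 4 := by
    intro k hk hkn
    obtain ⟨h1, h2⟩ := hb k hk hkn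
    have h3 := cot_le_inv (x := 8 * α + α * log k) (by linarith) (by linarith)
    have h4 : 1 / (8 * α + α * log k) ≤ 1 / (8 * α) := one_div_le_one_div_of_le (by linarith) h1
    calc 2 * α * cot (8 * α + α * log k) ≤ 2 * α * (1 / (8 * α)) :=
          mul_le_mul_of_nonneg_left (h3.trans h4) (by linarith)
      _ = 1 / 4 := by field_simp; norm_num
  have hlow : ∀ k : ℕ, 1 ≤ k → k ≤ n → 0 < 1 + 2 * α * cot (8 * α + α * log k) := by
    intro k hk hkn
    obtain ⟨h1, h2⟩ := hb k hk hkn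
    have h3 := neg_inv_le_cot (x := 8 * α + α * log k) (by linarith) (by linarith)
    have h4 : 1 / (π - (8 * α + α * log k)) ≤ 1 / (4 * α) :=
      one_div_le_one_div_of_le (by linarith) (by linarith)
    have h5 := mul_le_mul_of_nonneg_left ((neg_le_neg h4).trans h3) (show 0 ≤ 2 * α by linarith)
    have h6 : 2 * α * -(1 / (4 * α)) = -(1 / 2) := by field_simp; norm_num
    linarith
  have e0 : 4 / (1 + 4 * α ^ 2) = 1 / ((1 + 4 * α ^ 2) / 4) := by field_simp
  rw [e0]
  refine inv_mem_hardyConstants (by positivity) fun a ha => ?_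
  refine mul_hardySum_le_powerSum (by norm_num)
    (z := fun k => 2 * k / (1 + 2 * α * cot (8 * α + α * log k))) ?_ ?_ ?_ ha
  · intro k hk hkn
    have := hlow k hk hkn
    have hk0 : (0 : ℝ) < k := by exact_mod_cast hk
    positivity
  · have h := hup 1 le_rfl hn
    have e : (-(2 - 1) : ℝ) = -1 := by norm_num
    simp only [e, rpow_neg_one, inv_div, Nat.cast_one, mul_one] at h ⊢
    nlinarith
  · intro k hk hkn
    have hs := riccati_step_cot (φ := 8 * α) (k := k) hα0 (by exact_mod_cast hk)
      (by linarith [(hb k hk hkn.le).1])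
      (by have := (hb (k + 1) (by omega) hkn).2
          push_cast at this
          linarith)
      (hlow k hk hkn.le) (by linarith [hup k hk hkn.le])
    have e : (-(2 - 1) : ℝ) = -1 := by norm_num
    have e2 : ((k : ℝ) + 1) ^ (-2 : ℝ) * ((1 + 4 * α ^ 2) / 4)
        = (1 + 4 * α ^ 2) / (4 * ((k : ℝ) + 1) ^ 2) := by
      rw [rpow_neg (by positivity), rpow_ofNat]; field_simp
    simp only [e, rpow_neg_one, inv_div, Nat.cast_add, Nat.cast_one] at hs ⊢
    rw [e2]
    exact hs

/-! ### The equation for α -/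

open Real in
theorem existsUnique_isHardyRoot {p : ℝ} (hp : 1 < p) {n : ℕ} (hn : 1 ≤ n) :
    ∃! α : ℝ, IsHardyRoot p n α := by
  have hp1 : 0 < p - 1 := by linarith
  have hp0 : 0 < p := by linarith
  have hn1 : (1 : ℝ) ≤ n := by exact_mod_cast hn
  have hL : 0 < log ((n : ℝ) + 1) := log_pos (by linarith)
  unfold IsHardyRoot
  set L := log ((n : ℝ) + 1)
  have hpi := pi_pos
  have hmem : ∀ α, α ∈ Set.Ioo (π / (2 * L)) (π / L) → π / 2 < α * L ∧ α * L < π := by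
    rintro α ⟨h1, h2⟩
    rw [div_lt_iff₀ (by positivity)] at h1
    rw [lt_div_iff₀ hL] at h2
    constructor <;> linarith
  have hab : π / (2 * L) ≤ π / L := div_le_div_of_nonneg_left hpi.le hL (by linarith)
  -- Multiplying by the cosine removes the pole of the tangent at the left endpoint.
  have hcont : ContinuousOn (fun α => sin (α * L) + α * p / (p - 1) * cos (α * L))
      (Set.Icc (π / (2 * L)) (π / L)) := by fun_prop
  have hivt := intermediate_value_Ioo' hab hcont
  have ha : π / (2 * L) * L = π / 2 := by field_simp
  have hb : π / L * L = π := by field_simp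
  have h0 : (0 : ℝ) ∈ Set.Ioo
      (sin (π / L * L) + π / L * p / (p - 1) * cos (π / L * L))
      (sin (π / (2 * L) * L) + π / (2 * L) * p / (p - 1) * cos (π / (2 * L) * L)) := by
    rw [ha, hb]
    have : 0 < π / L * p / (p - 1) := by positivity
    simp only [sin_pi, cos_pi, sin_pi_div_two, cos_pi_div_two]
    constructor <;> linarith
  obtain ⟨α, hα, hroot⟩ := hivt h0
  have hα0 : tan (α * L) + α * p / (p - 1) = 0 := by
    obtain ⟨h1, h2⟩ := hmem α hα
    have hc : cos (α * L) < 0 := cos_neg_of_pi_div_two_lt_of_lt h1 (by linarith)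
    rw [tan_eq_sin_div_cos]
    have : sin (α * L) = - (α * p / (p - 1) * cos (α * L)) := by
      simp only at hroot; linarith
    rw [this, neg_div, mul_div_cancel_right₀ _ hc.ne]
    ring
  refine ⟨α, ⟨hα, hα0⟩, ?_⟩
  · have hmono : ∀ x y, x ∈ Set.Ioo (π / (2 * L)) (π / L) → y ∈ Set.Ioo (π / (2 * L)) (π / L) →
        x < y → tan (x * L) + x * p / (p - 1) < tan (y * L) + y * p / (p - 1) := by
      intro x y hx hy hxy
      obtain ⟨hx1, hx2⟩ := hmem x hx
      obtain ⟨hy1, hy2⟩ := hmem y hy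
      -- Shifting by π moves the angles into the principal branch, where tan increases.
      have h1 : x * L < y * L := mul_lt_mul_of_pos_right hxy hL
      have h2 := tan_lt_tan_of_lt_of_lt_pi_div_two (x := x * L - π) (y := y * L - π)
        (by linarith) (by linarith) (by linarith)
      rw [tan_sub_pi, tan_sub_pi] at h2
      have h3 : x * p / (p - 1) < y * p / (p - 1) := by gcongr
      linarith
    rintro β ⟨hβ, hβ0⟩
    rcases lt_trichotomy β α with h | h | h
    · have := hmono β α hβ hα h; linarith
    · exact h
    · have := hmono α β hα hβ h; linarith

/-! ### Lower bound from the sequence a_k* -/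

open Real in
/-- `q x^{1-1/p} sin (α ln x)`, a primitive of `f*`. -/
theorem hasDerivAt_primitive_fStar {p : ℝ} (hp : 1 < p) (α : ℝ) {x : ℝ} (hx : 0 < x) :
    HasDerivAt (fun y => p / (p - 1) * (y ^ (1 - 1 / p) * sin (α * log y))) (fStar p α x) x := by
  have h1 := Real.hasDerivAt_rpow_const (x := x) (p := 1 - 1 / p) (Or.inl hx.ne')
  have h2 := ((hasDerivAt_log hx.ne').const_mul α).sin
  refine ((h1.mul h2).const_mul (p / (p - 1))).congr_deriv ?_
  have hp1 : p - 1 ≠ 0 := by linarith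
  have hp0 : p ≠ 0 := by linarith
  have e1 : x ^ (1 - 1 / p - 1) = 1 / x ^ (1 / p) := by
    rw [show 1 - 1 / p - 1 = -(1 / p) by ring, rpow_neg hx.le, ← one_div (x ^ (1 / p))]
  have e2 : x ^ (1 - 1 / p) = x / x ^ (1 / p) := by
    rw [rpow_sub hx, rpow_one]
  have hxp : x ^ (1 / p) ≠ 0 := (rpow_pos_of_pos hx _).ne'
  rw [fStar, e1, e2]
  field_simp
  ring

theorem continuousOn_fStar (p α : ℝ) : ContinuousOn (fStar p α) (Set.Ioi 0) := by
  unfold fStar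
  have hlog : ContinuousOn Real.log (Set.Ioi 0) :=
    Real.continuousOn_log.mono fun x hx => (ne_of_gt hx : x ≠ 0)
  have hpow : ContinuousOn (fun x : ℝ => x ^ (1 / p)) (Set.Ioi 0) :=
    fun x hx => (Real.continuousAt_rpow_const x _ (Or.inl (ne_of_gt hx))).continuousWithinAt
  refine (continuousOn_const.div hpow fun x hx => (Real.rpow_pos_of_pos hx _).ne').mul ?_
  fun_prop

theorem integral_fStar {p : ℝ} (hp : 1 < p) (α : ℝ) {a b : ℝ} (ha : 0 < a) (hb : 0 < b) :
    ∫ x in a..b, fStar p α x = p / (p - 1) * (b ^ (1 - 1 / p) * Real.sin (α * Real.log b))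
      - p / (p - 1) * (a ^ (1 - 1 / p) * Real.sin (α * Real.log a)) := by
  have hsub : Set.uIcc a b ⊆ Set.Ioi 0 := fun x hx => lt_of_lt_of_le (lt_min ha hb) hx.1
  exact intervalIntegral.integral_eq_sub_of_hasDerivAt
    (fun x hx => hasDerivAt_primitive_fStar hp α (hsub hx))
    ((continuousOn_fStar p α).mono hsub).intervalIntegrable

/-- The integrals telescope, and the primitive vanishes at 1. -/
theorem sum_aStar {p : ℝ} (hp : 1 < p) (α : ℝ) (k : ℕ) :
    ∑ j ∈ Finset.Icc 1 k, aStar p α j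
      = p / (p - 1) * (((k : ℝ) + 1) ^ (1 - 1 / p) * Real.sin (α * Real.log ((k : ℝ) + 1))) := by
  induction k with
  | zero => simp
  | succ k ih =>
    rw [Finset.sum_Icc_succ_top (by omega), ih, aStar,
      integral_fStar hp α (by positivity) (by positivity)]
    push_cast
    ring

/-- Data derived from the equation for `α`: with `L = ln (n+1)` and `κ = - cos (α L)`. -/
structure RootData (p α L κ : ℝ) : Prop where
  α_pos : 0 < α
  αL_lt : α * L < Real.pi
  κ_pos : 0 < κ
  κ_sq : κ ^ 2 * (1 + (α * p / (p - 1)) ^ 2) = 1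
  comb : ∀ t, κ * (α * p / (p - 1) * Real.cos t + Real.sin t) = Real.sin (α * L - t)

open Real in
theorem IsHardyRoot.rootData {p : ℝ} {n : ℕ} (hn : 1 ≤ n) {α : ℝ}
    (h : IsHardyRoot p n α) :
    RootData p α (log ((n : ℝ) + 1)) (-cos (α * log ((n : ℝ) + 1))) := by
  have hn1 : (1 : ℝ) ≤ n := by exact_mod_cast hn
  have hL : 0 < log ((n : ℝ) + 1) := log_pos (by linarith)
  obtain ⟨⟨h1, h2⟩, h3⟩ := h
  set L := log ((n : ℝ) + 1)
  have hα0 : 0 < α := lt_trans (by positivity) h1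
  rw [div_lt_iff₀ (by positivity)] at h1
  rw [lt_div_iff₀ hL] at h2
  have hc : cos (α * L) < 0 :=
    cos_neg_of_pi_div_two_lt_of_lt (by linarith) (by linarith [pi_pos])
  rw [tan_eq_sin_div_cos] at h3
  have hs : sin (α * L) = -(α * p / (p - 1) * cos (α * L)) := by
    rw [div_add' _ _ _ hc.ne, div_eq_zero_iff] at h3
    rcases h3 with h3 | h3
    · linarith
    · exact absurd h3 hc.ne
  refine ⟨hα0, h2, by linarith, ?_, fun t => ?_⟩
  · have := sin_sq_add_cos_sq (α * L)
    rw [hs] at this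
    linarith
  · rw [sin_sub, hs]; ring

-- The root equation makes f* vanish at n + 1 and turns it, up to κ and the power of x, into the
-- sine of the primitive reflected by ln x ↦ L - ln x. Positivity of f* and the common integral of
-- both sums rest on this.
open Real in
theorem RootData.fStar_eq {p α L κ x : ℝ} (h : RootData p α L κ) :
    fStar p α x = 1 / x ^ (1 / p) * (sin (α * (L - log x)) / κ) := by
  rw [fStar, mul_sub, ← h.comb, mul_div_cancel_left₀ _ h.κ_pos.ne']

open Real in
theorem RootData.sin_pos {p α L κ t : ℝ} (h : RootData p α L κ) (h0 : 0 < t) (hL : t ≤ L) :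
    0 < sin (α * t) :=
  sin_pos_of_pos_of_lt_pi (mul_pos h.α_pos h0)
    ((mul_le_mul_of_nonneg_left hL h.α_pos.le).trans_lt h.αL_lt)

open Real in
theorem RootData.sin_nonneg {p α L κ t : ℝ} (h : RootData p α L κ) (h0 : 0 ≤ t) (hL : t ≤ L) :
    0 ≤ sin (α * t) := by
  rcases h0.eq_or_lt with rfl | h0
  · simp
  · exact (h.sin_pos h0 hL).le

open Real in
theorem RootData.fStar_pos {p α N κ x : ℝ} (h : RootData p α (log N) κ) (h1 : 1 ≤ x)
    (hN : x < N) : 0 < fStar p α x := by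
  have hx : 0 < x := by linarith
  rw [h.fStar_eq]
  have := h.sin_pos (t := log N - log x) (by linarith [log_lt_log hx hN])
    (by linarith [log_nonneg h1])
  have := h.κ_pos
  positivity

open Real in
theorem RootData.fStar_nonneg {p α N κ x : ℝ} (h : RootData p α (log N) κ) (h1 : 1 ≤ x)
    (hN : x ≤ N) : 0 ≤ fStar p α x := by
  have hx : 0 < x := by linarith
  rw [h.fStar_eq]
  have := h.sin_nonneg (t := log N - log x) (by linarith [log_le_log hx hN])
    (by linarith [log_nonneg h1])
  have := h.κ_pos
  positivity

theorem RootData.aStar_pos {p α κ : ℝ} {n k : ℕ} (h : RootData p α (Real.log ((n : ℝ) + 1)) κ)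
    (hk : 1 ≤ k) (hkn : k ≤ n) : 0 < aStar p α k := by
  have hk1 : (1 : ℝ) ≤ k := by exact_mod_cast hk
  have hkn1 : (k : ℝ) ≤ n := by exact_mod_cast hkn
  refine intervalIntegral.intervalIntegral_pos_of_pos_on ?_ (fun x hx => ?_) (by linarith)
  · refine ((continuousOn_fStar p α).mono fun x hx => ?_).intervalIntegrable
    rw [Set.uIcc_of_le (by linarith)] at hx
    exact lt_of_lt_of_le (by linarith) hx.1
  · exact h.fStar_pos (by linarith [hx.1]) (by linarith [hx.2])

/-- Jensen's inequality on an interval of length one. -/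
theorem rpow_integral_unit_le {p : ℝ} (hp : 1 ≤ p) {f : ℝ → ℝ} {c : ℝ}
    (hf : ContinuousOn f (Set.Icc c (c + 1))) (h0 : ∀ x ∈ Set.Icc c (c + 1), 0 ≤ f x) :
    (∫ x in c..c + 1, f x) ^ p ≤ ∫ x in c..c + 1, f x ^ p := by
  have hc : c ≤ c + 1 := by linarith
  rw [intervalIntegral.integral_of_le hc, intervalIntegral.integral_of_le hc]
  have : MeasureTheory.IsProbabilityMeasure
      (MeasureTheory.volume.restrict (Set.Ioc c (c + 1))) := ⟨by simp⟩
  have hfp : ContinuousOn (fun x => f x ^ p) (Set.Icc c (c + 1)) :=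
    hf.rpow_const fun x _ => Or.inr (by linarith)
  refine (convexOn_rpow hp).map_integral_le (f := f)
    (continuousOn_id.rpow_const fun x _ => Or.inr (by linarith)) isClosed_Ici ?_ ?_ ?_
  · filter_upwards [MeasureTheory.ae_restrict_mem measurableSet_Ioc] with x hx
    exact h0 x ⟨hx.1.le, hx.2⟩
  · exact (hf.integrableOn_Icc).mono_set Set.Ioc_subset_Icc_self
  · exact (hfp.integrableOn_Icc).mono_set Set.Ioc_subset_Icc_self

theorem sum_integral_Icc_one {f : ℝ → ℝ} (hf : ContinuousOn f (Set.Ioi 0)) (n : ℕ) :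
    ∑ k ∈ Finset.Icc 1 n, ∫ x in (k : ℝ)..((k : ℝ) + 1), f x = ∫ x in (1 : ℝ)..((n : ℝ) + 1), f x := by
  have hi : ∀ a b : ℝ, 0 < a → 0 < b → IntervalIntegrable f MeasureTheory.volume a b :=
    fun a b ha hb => (hf.mono fun x hx => lt_of_lt_of_le (lt_min ha hb) hx.1).intervalIntegrable
  induction n with
  | zero => simp
  | succ n ih =>
    rw [Finset.sum_Icc_succ_top (by omega), ih]
    push_cast
    exact intervalIntegral.integral_add_adjacent_intervals
      (hi _ _ (by positivity) (by positivity)) (hi _ _ (by positivity) (by positivity))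

open Real in
theorem integral_comp_log_mul_inv {g : ℝ → ℝ} (hg : Continuous g) {N : ℝ} (hN : 1 ≤ N) :
    ∫ x in (1 : ℝ)..N, g (log x) * x⁻¹ = ∫ t in (0 : ℝ)..log N, g t := by
  have hpos : ∀ x ∈ Set.uIcc 1 N, x ≠ 0 := by
    intro x hx
    rw [Set.uIcc_of_le hN] at hx
    linarith [hx.1]
  have h := intervalIntegral.integral_comp_mul_deriv (a := 1) (b := N) (f := log)
    (f' := fun x => x⁻¹) (fun x hx => hasDerivAt_log (hpos x hx))
    (continuousOn_inv₀.mono fun x hx => hpos x hx) hg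
  rwa [log_one] at h

theorem continuous_sin_rpow {p : ℝ} (hp : 0 ≤ p) (α : ℝ) :
    Continuous fun t => Real.sin (α * t) ^ p :=
  (by fun_prop : Continuous fun t => Real.sin (α * t)).rpow_const fun _ => Or.inr hp

-- Jensen on each [k, k+1] gives the integral of f*^p; the substitution t = ln x and the reflection
-- t ↦ L - t do the rest.
open Real in
theorem RootData.powerSum_le {p α κ : ℝ} {n : ℕ} (hp : 1 ≤ p)
    (h : RootData p α (log ((n : ℝ) + 1)) κ) :
    κ ^ p * powerSum p n (aStar p α) ≤ ∫ t in (0 : ℝ)..log ((n : ℝ) + 1), sin (α * t) ^ p := by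
  have hp0 : 0 < p := by linarith
  have hκ := h.κ_pos
  have hn0 : (0 : ℝ) ≤ n := by positivity
  have hcf := continuousOn_fStar p α
  have hcp : ContinuousOn (fun x => fStar p α x ^ p) (Set.Ioi 0) :=
    hcf.rpow_const fun x _ => Or.inr hp0.le
  have h1 : powerSum p n (aStar p α) ≤ ∫ x in (1 : ℝ)..((n : ℝ) + 1), fStar p α x ^ p := by
    rw [← sum_integral_Icc_one hcp]
    refine Finset.sum_le_sum fun k hk => ?_
    rw [Finset.mem_Icc] at hk
    have hk1 : (1 : ℝ) ≤ k := by exact_mod_cast hk.1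
    have hkn : (k : ℝ) ≤ n := by exact_mod_cast hk.2
    refine rpow_integral_unit_le hp (hcf.mono fun x hx => ?_) fun x hx => ?_
    · exact lt_of_lt_of_le (by linarith) hx.1
    · exact h.fStar_nonneg (by linarith [hx.1]) (by linarith [hx.2])
  refine (mul_le_mul_of_nonneg_left h1 (rpow_nonneg hκ.le p)).trans_eq ?_
  have hg : Continuous fun t => sin (α * (log ((n : ℝ) + 1) - t)) ^ p :=
    (continuous_sin_rpow hp0.le α).comp (continuous_const.sub continuous_id)
  have h2 := intervalIntegral.integral_comp_sub_left (a := 0) (b := log ((n : ℝ) + 1))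
    (fun t => sin (α * t) ^ p) (log ((n : ℝ) + 1))
  rw [sub_self, sub_zero] at h2
  rw [← h2, ← integral_comp_log_mul_inv hg (by linarith), ← intervalIntegral.integral_const_mul]
  refine intervalIntegral.integral_congr fun x hx => ?_
  rw [Set.uIcc_of_le (by linarith)] at hx
  have hx0 : 0 < x := by linarith [hx.1]
  have hs := h.sin_nonneg (t := log ((n : ℝ) + 1) - log x) (by linarith [log_le_log hx0 hx.2])
    (by linarith [log_nonneg hx.1])
  rw [h.fStar_eq, mul_rpow (by positivity) (by positivity), div_rpow hs hκ.le,
    div_rpow (by norm_num) (by positivity), one_rpow, ← rpow_mul hx0.le,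
    one_div_mul_cancel hp0.ne', rpow_one]
  have := (rpow_pos_of_pos hκ p).ne'
  field_simp

open Real in
theorem RootData.le_hardySum {p α κ : ℝ} {n : ℕ} (hp : 1 < p)
    (h : RootData p α (log ((n : ℝ) + 1)) κ) :
    (p / (p - 1)) ^ p * (∫ t in (0 : ℝ)..log ((n : ℝ) + 1), sin (α * t) ^ p)
      ≤ hardySum p n (aStar p α) := by
  have hp0 : 0 < p := by linarith
  have hp1 : 0 < p - 1 := by linarith
  have hq0 : 0 < p / (p - 1) := by positivity
  have hn0 : (0 : ℝ) ≤ n := by positivity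
  set q := p / (p - 1) with hq
  set g : ℝ → ℝ := fun x => sin (α * log x) ^ p * x⁻¹ with hg
  have hcg : ContinuousOn g (Set.Ioi 0) := by
    refine ContinuousOn.mul ?_ (continuousOn_inv₀.mono fun x hx => (ne_of_gt hx : x ≠ 0))
    exact (continuous_sin_rpow hp0.le α).comp_continuousOn
      (continuousOn_log.mono fun x hx => (ne_of_gt hx : x ≠ 0))
  rw [← integral_comp_log_mul_inv (continuous_sin_rpow hp0.le α) (by linarith),
    ← sum_integral_Icc_one hcg, Finset.mul_sum]
  refine Finset.sum_le_sum fun k hk => ?_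
  rw [Finset.mem_Icc] at hk
  have hk1 : (1 : ℝ) ≤ k := by exact_mod_cast hk.1
  have hkn : (k : ℝ) ≤ n := by exact_mod_cast hk.2
  rw [sum_aStar hp, ← intervalIntegral.integral_const_mul]
  -- The partial sum is the primitive F at k + 1. Since F increases (f* ≥ 0) and 1/x ≤ 1/k, the k-th
  -- term dominates (F(x)/x)^p = q^p sin(α ln x)^p / x on all of [k, k+1].
  have hconst : ∀ x ∈ Set.Icc (k : ℝ) ((k : ℝ) + 1), q ^ p * g x ≤
      (1 / (k : ℝ) * (q * (((k : ℝ) + 1) ^ (1 - 1 / p) * sin (α * log ((k : ℝ) + 1))))) ^ p := by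
    intro x hx
    have hx1 : 1 ≤ x := hk1.trans hx.1
    have hx0 : 0 < x := by linarith
    have hxn : x ≤ (n : ℝ) + 1 := by linarith [hx.2]
    have hs := h.sin_nonneg (t := log x) (log_nonneg hx1) (log_le_log hx0 hxn)
    have hF : q * (x ^ (1 - 1 / p) * sin (α * log x)) ≤
        q * (((k : ℝ) + 1) ^ (1 - 1 / p) * sin (α * log ((k : ℝ) + 1))) := by
      rw [← sub_nonneg, hq, ← integral_fStar hp α hx0 (by linarith)]
      refine intervalIntegral.integral_nonneg hx.2 fun y hy => ?_
      exact h.fStar_nonneg (by linarith [hy.1]) (by linarith [hy.2])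
    have hF0 : 0 ≤ q * (x ^ (1 - 1 / p) * sin (α * log x)) := by positivity
    have e : q ^ p * g x = (1 / x * (q * (x ^ (1 - 1 / p) * sin (α * log x)))) ^ p := by
      have e1 : 1 / x * (q * (x ^ (1 - 1 / p) * sin (α * log x)))
          = q * (sin (α * log x) / x ^ (1 / p)) := by
        rw [rpow_sub hx0, rpow_one]; field_simp
      rw [e1, mul_rpow hq0.le (by positivity), div_rpow hs (by positivity), ← rpow_mul hx0.le,
        one_div_mul_cancel hp0.ne', rpow_one, hg, div_eq_mul_inv]
    rw [e]
    refine rpow_le_rpow (by positivity) ?_ hp0.le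
    exact mul_le_mul (one_div_le_one_div_of_le (by linarith) hx.1) hF hF0 (by positivity)
  have hi : IntervalIntegrable (fun x => q ^ p * g x) MeasureTheory.volume k ((k : ℝ) + 1) := by
    refine ((continuousOn_const.mul hcg).mono fun x hx => ?_).intervalIntegrable
    rw [Set.uIcc_of_le (by linarith)] at hx
    exact lt_of_lt_of_le (by linarith) hx.1
  have h3 := intervalIntegral.integral_mono_on (by linarith) hi
    (intervalIntegrable_const (μ := MeasureTheory.volume)) hconst
  simpa using h3

open Real in
theorem IsHardyRoot.quotient_bound {p : ℝ} (hp : 2 ≤ p) {n : ℕ} (hn : 2 ≤ n) {α : ℝ}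
    (hα : IsHardyRoot p n α) :
    ((p / (p - 1)) ^ p - ((p / (p - 1)) ^ (p + 1) * p * π ^ 2) / log n ^ 2)
      * powerSum p n (aStar p α) ≤ hardySum p n (aStar p α) := by
  have hp1 : 0 < p - 1 := by linarith
  have h := hα.rootData (by omega)
  have hα2 := hα.1.2
  have hn2 : (2 : ℝ) ≤ n := by exact_mod_cast hn
  have hl : 0 < log n := log_pos (by linarith)
  have hlL : log n ≤ log ((n : ℝ) + 1) := log_le_log (by linarith) (by linarith)
  set κ := -cos (α * log ((n : ℝ) + 1))
  have hκ := h.κ_pos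
  have hP : 0 ≤ powerSum p n (aStar p α) := powerSum_nonneg fun k hk => by
    rw [Finset.mem_Icc] at hk
    exact (h.aStar_pos hk.1 hk.2).le
  have h1 := h.powerSum_le (by linarith)
  have h2 := h.le_hardySum (by linarith)
  set q := p / (p - 1) with hq
  have hq0 : 0 < q := by positivity
  have hqp : 0 < q ^ p := rpow_pos_of_pos hq0 p
  have hq2 : q ≤ 2 := by rw [hq, div_le_iff₀ hp1]; linarith
  have hγ : α * p / (p - 1) = α * q := by rw [hq]; ring
  have hκp : 1 - p / 2 * (α * q) ^ 2 ≤ κ ^ p := by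
    have e : κ = (1 + (α * q) ^ 2) ^ (-(1 / 2) : ℝ) := by
      have hsq := h.κ_sq
      rw [hγ] at hsq
      have hpos : 0 < 1 + (α * q) ^ 2 := by positivity
      rw [rpow_neg hpos.le, ← sqrt_eq_rpow, ← sqrt_inv, eq_comm, sqrt_eq_iff_mul_self_eq_of_pos hκ,
        ← sq]
      exact eq_inv_of_mul_eq_one_left hsq
    rw [e, ← rpow_mul (by positivity), show -(1 / 2) * p = -(p / 2) by ring]
    exact one_sub_mul_le_one_add_rpow_neg (by have := sq_nonneg (α * q); linarith) (by linarith)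
  have hαl : α ≤ π / log n := hα2.le.trans (div_le_div_of_nonneg_left pi_pos.le hl hlL)
  have hα2 : α ^ 2 ≤ π ^ 2 / log n ^ 2 := by
    rw [← div_pow]
    exact pow_le_pow_left₀ h.α_pos.le hαl 2
  have hcoef : q ^ p - (q ^ (p + 1) * p * π ^ 2) / log n ^ 2 ≤ q ^ p * κ ^ p := by
    have e : q ^ p - (q ^ (p + 1) * p * π ^ 2) / log n ^ 2
        = q ^ p * (1 - q * p * (π ^ 2 / log n ^ 2)) := by
      rw [rpow_add hq0, rpow_one]; ring
    rw [e]
    refine mul_le_mul_of_nonneg_left (le_trans ?_ hκp) hqp.le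
    -- The only use of q ≤ 2; there is equality at p = 2, so nothing is lost in the exact case.
    have h3 : p / 2 * (α * q) ^ 2 ≤ q * p * α ^ 2 := by
      have : 0 ≤ p * q * α ^ 2 * (2 - q) := by
        have : 0 ≤ 2 - q := by linarith
        positivity
      linarith
    have h4 := mul_le_mul_of_nonneg_left hα2 (show 0 ≤ q * p by positivity)
    linarith
  calc _ ≤ q ^ p * κ ^ p * powerSum p n (aStar p α) := mul_le_mul_of_nonneg_right hcoef hP
    _ = q ^ p * (κ ^ p * powerSum p n (aStar p α)) := by ring
    _ ≤ _ := (mul_le_mul_of_nonneg_left h1 hqp.le).trans h2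

theorem le_hardyConst {p : ℝ} (hp : 2 ≤ p) {n : ℕ} (hn : 2 ≤ n) :
    (p / (p - 1)) ^ p - ((p / (p - 1)) ^ (p + 1) * p * Real.pi ^ 2) / Real.log n ^ 2
      ≤ hardyConst p n := by
  obtain ⟨α, hα, -⟩ := existsUnique_isHardyRoot (show 1 < p by linarith) (show 1 ≤ n by omega)
  have h := hα.rootData (by omega)
  have hpos : ∀ k ∈ Finset.Icc 1 n, 0 < aStar p α k := fun k hk => by
    rw [Finset.mem_Icc] at hk
    exact h.aStar_pos hk.1 hk.2
  have hP : 0 < powerSum p n (aStar p α) :=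
    Finset.sum_pos (fun k hk => Real.rpow_pos_of_pos (hpos k hk) p) ⟨1, by simp; omega⟩
  have h1 := hα.quotient_bound hp hn
  have h2 := (isLeast_hardyConst hp hn).1 _ fun k hk => (hpos k hk).le
  exact le_of_mul_le_mul_right (h1.trans h2) hP

/-! ### The limit for p = 2 and the conclusion -/

open Real Filter in
theorem tendsto_hardyConst_two :
    Tendsto (fun n : ℕ => (4 - hardyConst 2 n) * log n ^ 2) atTop (nhds (16 * π ^ 2)) := by
  have hlog : Tendsto (fun n : ℕ => log n) atTop atTop :=
    tendsto_log_atTop.comp tendsto_natCast_atTop_atTop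
  have hlow : Tendsto (fun n : ℕ => 16 * π ^ 2 / ((1 + 12 * (log n)⁻¹) ^ 2 +
      4 * π ^ 2 * (log n)⁻¹ ^ 2)) atTop (nhds (16 * π ^ 2)) := by
    have hi := hlog.inv_tendsto_atTop
    have h1 := (((hi.const_mul 12).const_add 1).pow 2).add ((hi.pow 2).const_mul (4 * π ^ 2))
    have h2 := (tendsto_const_nhds (x := 16 * π ^ 2)).div h1 (by norm_num)
    simpa [Pi.div_def] using h2
  refine tendsto_of_tendsto_of_tendsto_of_le_of_le' hlow tendsto_const_nhds ?_ ?_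
  · filter_upwards [eventually_ge_atTop 2] with n hn
    have hn2 : (2 : ℝ) ≤ n := by exact_mod_cast hn
    have hl : 0 < log n := log_pos (by linarith)
    -- The gap 4 - 4/(1+4α²) = 16α²/(1+4α²) with α = π/(ln n + 12) has the right asymptotics; the
    -- shift 12 disappears in the limit.
    have h := (isLeast_hardyConst le_rfl hn).2 (mem_hardyConstants_two (by omega) rfl)
    have e : 16 * π ^ 2 / ((1 + 12 * (log n)⁻¹) ^ 2 + 4 * π ^ 2 * (log n)⁻¹ ^ 2)
        = (4 - 4 / (1 + 4 * (π / (log n + 12)) ^ 2)) * log n ^ 2 := by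
      field_simp
      ring
    rw [e]
    exact mul_le_mul_of_nonneg_right (by linarith) (by positivity)
  · filter_upwards [eventually_ge_atTop 2] with n hn
    have hn2 : (2 : ℝ) ≤ n := by exact_mod_cast hn
    have hl : 0 < log n := log_pos (by linarith)
    have h := le_hardyConst le_rfl hn
    norm_num at h
    rw [← le_div_iff₀ (by positivity)]
    linarith

theorem theorem1p5 (p : ℝ) (hp : 2 ≤ p) :
    -- the best constant exists (it is attained as a minimum of the admissible constants)
    (∀ n : ℕ, 2 ≤ n → IsLeast (hardyConstants p n) (hardyConst p n)) ∧
    -- `α` is well defined and the sequence `a_k*` is admissible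
    (∀ n : ℕ, 2 ≤ n → ∃! α : ℝ, IsHardyRoot p n α) ∧
    (∀ n : ℕ, 2 ≤ n → ∀ α : ℝ, IsHardyRoot p n α → ∀ k ∈ Finset.Icc 1 n, 0 < aStar p α k) ∧
    -- two-sided estimate, and the lower bound is attained by `a_k*`
    (∃ c₃ : ℝ, 0 < c₃ ∧ ∃ c₄ : ℝ, 0 < c₄ ∧ ∀ n : ℕ, 2 ≤ n →
      (p / (p - 1)) ^ p - c₃ / Real.log n ^ 2 ≤ hardyConst p n ∧
      hardyConst p n ≤ (p / (p - 1)) ^ p - c₄ / Real.log n ^ 2 ∧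
      ∀ α : ℝ, IsHardyRoot p n α →
        ((p / (p - 1)) ^ p - c₃ / Real.log n ^ 2) * powerSum p n (aStar p α)
          ≤ hardySum p n (aStar p α)) ∧
    -- for all large `n` one may take `c₃ = (p/(p-1))^(p+1) p π²`
    (∃ N : ℕ, ∀ n : ℕ, N ≤ n →
      (p / (p - 1)) ^ p - ((p / (p - 1)) ^ (p + 1) * p * Real.pi ^ 2) / Real.log n ^ 2
        ≤ hardyConst p n ∧
      ∀ α : ℝ, IsHardyRoot p n α →
        ((p / (p - 1)) ^ p - ((p / (p - 1)) ^ (p + 1) * p * Real.pi ^ 2) / Real.log n ^ 2)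
            * powerSum p n (aStar p α)
          ≤ hardySum p n (aStar p α)) ∧
    -- and this constant is exact for `p = 2`
    (p = 2 → Filter.Tendsto
      (fun n : ℕ => ((p / (p - 1)) ^ p - hardyConst p n) * Real.log n ^ 2) Filter.atTop
      (nhds ((p / (p - 1)) ^ (p + 1) * p * Real.pi ^ 2))) := by
  have hp1 : 0 < p - 1 := by linarith
  -- C(p) works from n = 2 on, so it also serves as c₃ and N = 2 suffices.
  refine ⟨fun n hn => isLeast_hardyConst hp hn,
    fun n hn => existsUnique_isHardyRoot (by linarith) (by omega),
    fun n hn α hα k hk => ?_,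
    ⟨(p / (p - 1)) ^ (p + 1) * p * Real.pi ^ 2, by positivity,
      (p / (p - 1)) ^ p / (64 * p), by positivity, fun n hn =>
        ⟨le_hardyConst hp hn, ?_, fun α hα => hα.quotient_bound hp hn⟩⟩,
    ⟨2, fun n hn => ⟨le_hardyConst hp hn, fun α hα => hα.quotient_bound hp hn⟩⟩, ?_⟩
  · rw [Finset.mem_Icc] at hk
    exact (hα.rootData (by omega)).aStar_pos hk.1 hk.2
  · obtain ⟨d, hd, hle⟩ := exists_mem_hardyConstants_le hp hn
    exact ((isLeast_hardyConst hp hn).2 hd).trans hle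
  · rintro rfl
    have e1 : ((2 : ℝ) / (2 - 1)) ^ (2 : ℝ) = 4 := by norm_num
    have e2 : ((2 : ℝ) / (2 - 1)) ^ (2 + 1 : ℝ) * 2 = 16 := by norm_num
    rw [e1, e2]
    exact tendsto_hardyConst_two
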